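/- **Models.** A $\wedge_d$-FBDD (Decision DNNF) is a finite directed acyclic graph $B$ with a single source and exactly two sinks, labelled $0$ and $1$. Every other node has two outgoing edges and is either a conjunction node or a decision node labelled by a variable, one outgoing edge of a decision node being labelled $0$ and the other $1$. The variables labelling decision nodes reachable from one child of a conjunction node are disjoint from those reachable from its other child, and no directed path connects two decision nodes labelled by the same variable. The set $\mathcal A(B_u)$ of partial assignments accepted at a node $u$ is $\{\emptyset\}$ at the $1$-sink and $\emptyset$ at the $0$-sink. At a decision node labelled $x$ with $0$-child $u_0$ and $1$-child $u_1$ it is $\{a\cup\{(x,0)\} : a\in\mathcal A(B_{u_0})\}\cup\{a\cup\{(x,1)\} : a\in\mathcal A(B_{u_1})\}$, and at a conjunction node with children $u_0,u_1$ it is $\{a\cup b : a\in\mathcal A(B_{u_0}),\ b\in\mathcal A(B_{u_1})\}$. $B$ represents a CNF $\varphi$ if the variables labelling its decision nodes are exactly the variables of $\varphi$, and an assignment of these variables satisfies $\varphi$ if and only if it extends an assignment accepted at the source of $B$. The size $|B|$ is the number of nodes. An FBDD is a $\wedge_d$-FBDD without conjunction nodes. A $\wedge_d$-OBDD is a $\wedge_d$-FBDD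 for which there is a linear order of the variables such that along every directed path the variables of the decision nodes are increasing. **The CNFs.** For a graph $G$ with vertex set $V$ take two disjoint copies $V[1]=\{v[1]:v\in V\}$ and $V[2]=\{v[2]:v\in V\}$ of $V$ as variables, and let $\psi(G)$ be the CNF with the clauses $(u[1]\vee v[2])$ and $(v[1]\vee u[2])$ for all edges $\{u,v\}$ of $G$, together with the two clauses $\bigvee_{v\in V}\neg v[1]$ and $\bigvee_{v\in V}\neg v[2]$. For $n\ge 1$ let $G_n$ be the $n\times n$ grid with vertex set $\{1,\dots,n\}^2$, let $E_{hor}$ be the set of its horizontal edges $\{(i,j),(i,j+1)\}$ and $E_{vert}$ the set of its vertical edges $\{(i,j),(i+1,j)\}$, and let $G_n[E_{hor}]$, $G_n[E_{vert}]$ be the spanning subgraphs with these edge sets. Let $\textsc{jn}$ be an additional (junction) variable and $$\psi_n=\psi(G_n,E_{hor},E_{vert})=(\textsc{jn}\rightarrow\psi(G_n[E_{hor}]))\wedge(\neg\textsc{jn}\rightarrow\psi(G_n[E_{vert}])),$$ written as a CNF by adding the literal $\neg\textsc{jn}$ to every clause of $\psi(G_n[E_{hor}])$ and the literal $\textsc{jn}$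 to every clause of $\psi(G_n[E_{vert}])$. **Theorem.** For every $n\ge1$ the CNF $\psi_n$ has exactly $2n^2+1$ variables (so the $\psi_n$ form an infinite class), and the following hold. 1. There are constants $C,k\in\mathbb N$ such that for every $n\ge 1$ there is an FBDD of size at most $C\,n^k$ representing $\psi_n$. 2. There is a constant $c>0$ such that for every $n\ge 1$ every $\wedge_d$-OBDD representing $\psi_n$ has size at least $2^{cn}$. Thus there is an infinite class of CNFs that is polynomially representable by FBDDs but requires exponential-size $\wedge_d$-OBDDs. -/

import Mathlib

/-! ### CNFs -/

/-- A literal over the variables `W`: `(x, true)` is the literal `x`, `(x, false)` is `¬ x`. -/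
abbrev Lit (W : Type) : Type := W × Bool

/-- A CNF is a finite set of clauses, a clause is a finite set of literals. -/
abbrev CNF (W : Type) : Type := Finset (Finset (Lit W))

namespace CNF

/-- The variables occurring in a CNF. -/
def vars {W : Type} [DecidableEq W] (φ : CNF W) : Finset W :=
  φ.biUnion fun C => C.image Prod.fst

/-- An assignment satisfies a CNF if every clause contains a literal that it makes true. -/
def Sat {W : Type} (φ : CNF W) (b : W → Bool) : Prop :=
  ∀ C ∈ φ, ∃ l ∈ C, b l.1 = l.2

/-- `φ(G)`: the clauses `(u ∨ v)` for the edges `{u, v}` of `G`. -/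
def phi {W : Type} [Fintype W] [DecidableEq W] (G : SimpleGraph W) [DecidableRel G.Adj] :
    CNF W :=
  (Finset.univ.filter fun p : W × W => G.Adj p.1 p.2).image
    fun p => {(p.1, true), (p.2, true)}

/-- `ψ(G)`: the CNF `φ(G*)`, where `G*` is the bipartite double cover of `G` on the two copies
`V[1] = inl V` and `V[2] = inr V` of the vertices (edges `{u[1], v[2]}` and `{v[1], u[2]}` for
every edge `{u, v}` of `G`), together with the two clauses `¬V[1]` and `¬V[2]`. -/
def psi {V : Type} [Fintype V] [DecidableEq V] (G : SimpleGraph V) [DecidableRel G.Adj] :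
    CNF (V ⊕ V) :=
  phi G.bipartiteDoubleCover ∪
    {Finset.univ.image fun v : V => ((Sum.inl v : V ⊕ V), false),
     Finset.univ.image fun v : V => ((Sum.inr v : V ⊕ V), false)}

/-- Every clause `C` of `φ` is replaced by `ℓ ∨ C`, where `ℓ = (jn, i)` is a literal of the new
variable `jn = none`. -/
def guard {W : Type} [DecidableEq W] (i : Bool) (φ : CNF W) : CNF (Option W) :=
  φ.image fun C => insert ((none : Option W), i) (C.image fun l => (some l.1, l.2))

/-- The CNF of `(jn → φ₁) ∧ (¬ jn → φ₂)`, with the junction variable `jn = none`. -/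
def junction {W : Type} [DecidableEq W] (φ₁ φ₂ : CNF W) : CNF (Option W) :=
  guard false φ₁ ∪ guard true φ₂

theorem sat_guard {W : Type} [DecidableEq W] (i : Bool) (φ : CNF W) (b : Option W → Bool) :
    (guard i φ).Sat b ↔ (b none = i ∨ φ.Sat fun x => b (some x)) := by
  simp only [Sat, guard, Finset.forall_mem_image, Finset.exists_mem_insert,
    Finset.exists_mem_image]
  by_cases h : b none = i <;> simp [h]

/-- The CNF `junction φ₁ φ₂` computes the function `(jn → φ₁) ∧ (¬ jn → φ₂)`. -/
theorem sat_junction {W : Type} [DecidableEq W] (φ₁ φ₂ : CNF W) (b : Option W → Bool) :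
    (junction φ₁ φ₂).Sat b ↔
      ((b none = true → φ₁.Sat fun x => b (some x)) ∧
       (b none = false → φ₂.Sat fun x => b (some x))) := by
  have h : (junction φ₁ φ₂).Sat b ↔ (guard false φ₁).Sat b ∧ (guard true φ₂).Sat b := by
    simp only [Sat, junction, Finset.mem_union]
    exact ⟨fun h => ⟨fun C hC => h C (Or.inl hC), fun C hC => h C (Or.inr hC)⟩,
      fun h C hC => hC.elim (h.1 C) (h.2 C)⟩
  rw [h, sat_guard, sat_guard]
  cases hb : b none <;> simp

end CNF

/-! ### Grids -/

/-- The spanning subgraph `G_n[E_hor]` of the `n × n` grid: edges `{(i, j), (i, j + 1)}`. -/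
def horGrid (n : ℕ) : SimpleGraph (Fin n × Fin n) where
  Adj p q := p.1 = q.1 ∧ (p.2.val + 1 = q.2.val ∨ q.2.val + 1 = p.2.val)
  symm := ⟨fun _ _ h => ⟨h.1.symm, h.2.symm⟩⟩
  loopless := ⟨fun _ h => by have := h.2; omega⟩

/-- The spanning subgraph `G_n[E_vert]` of the `n × n` grid: edges `{(i, j), (i + 1, j)}`. -/
def vertGrid (n : ℕ) : SimpleGraph (Fin n × Fin n) where
  Adj p q := p.2 = q.2 ∧ (p.1.val + 1 = q.1.val ∨ q.1.val + 1 = p.1.val)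
  symm := ⟨fun _ _ h => ⟨h.1.symm, h.2.symm⟩⟩
  loopless := ⟨fun _ h => by have := h.2; omega⟩

instance (n : ℕ) : DecidableRel (horGrid n).Adj := fun p q =>
  inferInstanceAs (Decidable (p.1 = q.1 ∧ (p.2.val + 1 = q.2.val ∨ q.2.val + 1 = p.2.val)))

instance (n : ℕ) : DecidableRel (vertGrid n).Adj := fun p q =>
  inferInstanceAs (Decidable (p.2 = q.2 ∧ (p.1.val + 1 = q.1.val ∨ q.1.val + 1 = p.1.val)))

/-- The variables of the grid CNF: the junction variable `none`, and two copies of the vertices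
of the `n × n` grid. -/
abbrev GridVar (n : ℕ) : Type := Option ((Fin n × Fin n) ⊕ (Fin n × Fin n))

/-- The CNF `ψ(G_n, E_hor, E_vert)`, that is `(jn → ψ(G_n[E_hor])) ∧ (¬ jn → ψ(G_n[E_vert]))`. -/
def psiGrid (n : ℕ) : CNF (GridVar n) :=
  CNF.junction (CNF.psi (horGrid n)) (CNF.psi (vertGrid n))

/-! ### Decision diagrams with decomposable conjunction -/

/-- The label of a node in a diagram with variables `W` and nodes `N`, with the out-neighbours of
the node: a sink; a decision node for `x`, whose edges labelled `0` and `1` lead to `lo` and `hi`;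
a conjunction node. -/
inductive NodeLabel (W N : Type) : Type
  | sink (i : Bool) : NodeLabel W N
  | decision (x : W) (lo hi : N) : NodeLabel W N
  | conj (left right : N) : NodeLabel W N

/-- The children of a node with the given label. -/
def NodeLabel.children {W N : Type} : NodeLabel W N → Set N
  | .sink _ => ∅
  | .decision _ lo hi => {lo, hi}
  | .conj l r => {l, r}

/-- There is an edge from `u` to `v`. -/
def DiagramEdge {W N : Type} (label : N → NodeLabel W N) (u v : N) : Prop :=
  v ∈ (label u).children

/-- The variables labelling decision nodes that are reachable from `u` (including `u`). -/
def varsBelow {W N : Type} (label : N → NodeLabel W N) (u : N) : Set W :=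
  {x | ∃ w lo hi, Relation.ReflTransGen (DiagramEdge label) u w ∧ label w = .decision x lo hi}

/-- `∧_d`-FBDDs, also known as Decision DNNFs. -/
structure AndFBDD (W : Type) where
  /-- The nodes. -/
  Node : Type
  [fintypeNode : Fintype Node]
  /-- Labels and children of the nodes. -/
  label : Node → NodeLabel W Node
  /-- The source. -/
  source : Node
  /-- The diagram is acyclic. -/
  acyclic : ∀ u, ¬ Relation.TransGen (DiagramEdge label) u u
  /-- The source is the only node without incoming edges. -/
  single_source : ∀ u, (∀ w, ¬ DiagramEdge label w u) ↔ u = source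
  /-- There are exactly two sinks, one labelled by `0` and one labelled by `1`. -/
  two_sinks : ∀ i, ∃! u, label u = .sink i
  /-- The subdiagrams below the two children of a conjunction node share no variable. -/
  decomposable : ∀ u l r, label u = .conj l r → Disjoint (varsBelow label l) (varsBelow label r)
  /-- No directed path connects two decision nodes that are labelled by the same variable. -/
  read_once : ∀ u v x lo hi lo' hi', label u = .decision x lo hi → label v = .decision x lo' hi' →
    ¬ Relation.TransGen (DiagramEdge label) u v

namespace AndFBDD

variable {W : Type}

/-- The size is the number of nodes. -/
def size (B : AndFBDD W) : ℕ := @Fintype.card B.Node B.fintypeNode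

/-- The variables labelling the decision nodes of `B`. -/
def vars (B : AndFBDD W) : Set W := {x | ∃ u lo hi, B.label u = .decision x lo hi}

/-- `B.Accepts u a` says that the partial assignment `a`, a set of pairs `(x, i)`, belongs to the
set `𝒜(B_u)` of assignments accepted by the subdiagram with source `u`. -/
inductive Accepts (B : AndFBDD W) : B.Node → Set (W × Bool) → Prop
  | sink_one {u : B.Node} (h : B.label u = .sink true) : Accepts B u ∅
  | decision_zero {u : B.Node} {x : W} {lo hi : B.Node} {a : Set (W × Bool)}
      (h : B.label u = .decision x lo hi) (ha : Accepts B lo a) :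
      Accepts B u (insert (x, false) a)
  | decision_one {u : B.Node} {x : W} {lo hi : B.Node} {a : Set (W × Bool)}
      (h : B.label u = .decision x lo hi) (ha : Accepts B hi a) :
      Accepts B u (insert (x, true) a)
  | conj {u l r : B.Node} {a₁ a₂ : Set (W × Bool)}
      (h : B.label u = .conj l r) (h₁ : Accepts B l a₁) (h₂ : Accepts B r a₂) :
      Accepts B u (a₁ ∪ a₂)

/-- `b` is a satisfying assignment of `B` if it extends an assignment accepted by `B`. This
depends only on the values of `b` at the variables of `B`. -/
def Sat (B : AndFBDD W) (b : W → Bool) : Prop :=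
  ∃ a, B.Accepts B.source a ∧ ∀ l ∈ a, b l.1 = l.2

/-- `B` represents the CNF `φ`: they have the same variables and the same satisfying
assignments. -/
def Represents [DecidableEq W] (B : AndFBDD W) (φ : CNF W) : Prop :=
  B.vars = (φ.vars : Set W) ∧ ∀ b : W → Bool, B.Sat b ↔ φ.Sat b

/-- An FBDD is an `∧_d`-FBDD without conjunction nodes. -/
def IsFBDD (B : AndFBDD W) : Prop := ∀ u l r, B.label u ≠ .conj l r

/-- `B` obeys the linear order `π`: along every directed path, the variables of the decision
nodes increase. -/
def Obeys (B : AndFBDD W) (π : LinearOrder W) : Prop :=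
  ∀ u v x y lo hi lo' hi', B.label u = .decision x lo hi → B.label v = .decision y lo' hi' →
    Relation.TransGen (DiagramEdge B.label) u v → π.lt x y

/-- An `∧_d`-OBDD is an `∧_d`-FBDD that obeys some linear order of the variables. -/
def IsAndOBDD (B : AndFBDD W) : Prop := ∃ π : LinearOrder W, B.Obeys π

end AndFBDD

/-! Lower bound. Fix a `∧_d`-OBDD and an initial segment `P` of its order. Suppose `G` has an
induced matching `u i`–`v i` with the copies `s` of the `u i` in `P` and the copies `!s` of the `v
i` outside. For a set `I` of indices let `β I` be `0` exactly at the copies of the `u i` with `i ∉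
I`. It violates the all-negative clause of copy `!s`. Setting the copy of `v k` to `0` repairs it if
`k ∈ I`, but violates the edge `u k`–`v k` if `k ∉ I`. These assignments form a fooling set that
conjunction nodes cannot evade. Descend from the source, following `β I` at decisions on `P` and the
rejecting child at conjunctions. All repairs happen below the rejecting child, so by decomposability
the other child keeps accepting (`Pivot.descend_conj`). The descent ends at a decision node outside
`P`, and distinct `I` end at distinct nodes (`card_le_size_of_fooling`).

To find such a matching, choose for every grid vertex the copy given by its parity, so that grid
edges become edges of the double cover, and let `P` contain half of the chosen variables. A balanced
2-colouring of the grid has about `n / 2` non-constant rows or as many non-constant columns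
(`card_mixed_lines`). Each such line has an edge crossing `P`, different lines are not joined, and
half of the crossing edges start in the same copy.

Upper bound. After reading the junction variable only rows or only columns matter. The double cover
of a line is two paths, so an automaton reading path after path needs constant memory, and unrolling
it in time gives an FBDD. -/

/-! ### Acceptance at a node -/

/-- `b` extends an assignment accepted at the node `u`. -/
def AndFBDD.SatAt {W : Type} (B : AndFBDD W) (u : B.Node) (b : W → Bool) : Prop :=
  ∃ a, B.Accepts u a ∧ ∀ l ∈ a, b l.1 = l.2

theorem varsBelow_mono {W N : Type} {label : N → NodeLabel W N} {u v : N}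
    (h : DiagramEdge label u v) : varsBelow label v ⊆ varsBelow label u := by
  rintro x ⟨w, lo, hi, hw, hx⟩
  exact ⟨w, lo, hi, Relation.ReflTransGen.head h hw, hx⟩

theorem diagramEdge_lo {W N : Type} {label : N → NodeLabel W N} {u lo hi : N} {x : W}
    (h : label u = .decision x lo hi) : DiagramEdge label u lo := by
  simp [DiagramEdge, h, NodeLabel.children]

theorem diagramEdge_hi {W N : Type} {label : N → NodeLabel W N} {u lo hi : N} {x : W}
    (h : label u = .decision x lo hi) : DiagramEdge label u hi := by
  simp [DiagramEdge, h, NodeLabel.children]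

theorem diagramEdge_left {W N : Type} {label : N → NodeLabel W N} {u l r : N}
    (h : label u = .conj l r) : DiagramEdge label u l := by
  simp [DiagramEdge, h, NodeLabel.children]

theorem diagramEdge_right {W N : Type} {label : N → NodeLabel W N} {u l r : N}
    (h : label u = .conj l r) : DiagramEdge label u r := by
  simp [DiagramEdge, h, NodeLabel.children]

namespace AndFBDD

variable {W : Type} {B : AndFBDD W}

theorem Accepts.mem_varsBelow {u : B.Node} {a : Set (W × Bool)} (h : B.Accepts u a) :
    ∀ l ∈ a, l.1 ∈ varsBelow B.label u := by
  induction h with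
  | sink_one h => simp
  | decision_zero h _ ih =>
    rintro l (rfl | hl)
    · exact ⟨_, _, _, .refl, h⟩
    · exact varsBelow_mono (diagramEdge_lo h) (ih l hl)
  | decision_one h _ ih =>
    rintro l (rfl | hl)
    · exact ⟨_, _, _, .refl, h⟩
    · exact varsBelow_mono (diagramEdge_hi h) (ih l hl)
  | conj h _ _ ih₁ ih₂ =>
    rintro l (hl | hl)
    · exact varsBelow_mono (diagramEdge_left h) (ih₁ l hl)
    · exact varsBelow_mono (diagramEdge_right h) (ih₂ l hl)

theorem SatAt.congr {u : B.Node} {b b' : W → Bool} (h : B.SatAt u b)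
    (hb : ∀ x ∈ varsBelow B.label u, b x = b' x) : B.SatAt u b' := by
  obtain ⟨a, ha, hl⟩ := h
  exact ⟨a, ha, fun l h => (hb _ (ha.mem_varsBelow l h)).symm.trans (hl l h)⟩

theorem satAt_sink {u : B.Node} {i : Bool} (h : B.label u = .sink i) (b : W → Bool) :
    B.SatAt u b ↔ i = true := by
  constructor
  · rintro ⟨a, ha, -⟩
    cases ha <;> simp_all
  · rintro rfl
    exact ⟨∅, .sink_one h, by simp⟩

theorem satAt_decision {u lo hi : B.Node} {x : W} (h : B.label u = .decision x lo hi)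
    (b : W → Bool) : B.SatAt u b ↔ B.SatAt (if b x then hi else lo) b := by
  constructor
  · rintro ⟨a, ha, hl⟩
    cases ha with
    | sink_one h' => simp_all
    | conj h' => simp_all
    | decision_zero h' ha =>
      rw [h] at h'
      cases h'
      have := hl _ (Set.mem_insert _ _)
      simp only at this
      simpa [this] using ⟨_, ha, fun l h => hl l (Set.mem_insert_of_mem _ h)⟩
    | decision_one h' ha =>
      rw [h] at h'
      cases h'
      have := hl _ (Set.mem_insert _ _)
      simp only at this
      simpa [this] using ⟨_, ha, fun l h => hl l (Set.mem_insert_of_mem _ h)⟩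
  · cases hx : b x
    · rintro ⟨a, ha, hl⟩
      refine ⟨_, .decision_zero h ha, ?_⟩
      rintro l (rfl | hl')
      exacts [hx, hl l hl']
    · rintro ⟨a, ha, hl⟩
      refine ⟨_, .decision_one h ha, ?_⟩
      rintro l (rfl | hl')
      exacts [hx, hl l hl']

theorem satAt_conj {u l r : B.Node} (h : B.label u = .conj l r) (b : W → Bool) :
    B.SatAt u b ↔ B.SatAt l b ∧ B.SatAt r b := by
  constructor
  · rintro ⟨a, ha, hl⟩
    cases ha with
    | sink_one h' => simp_all
    | decision_zero h' => simp_all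
    | decision_one h' => simp_all
    | conj h' h₁ h₂ =>
      rw [h] at h'
      cases h'
      exact ⟨⟨_, h₁, fun l h => hl l (Or.inl h)⟩, ⟨_, h₂, fun l h => hl l (Or.inr h)⟩⟩
  · rintro ⟨⟨a, ha, hl⟩, ⟨a', ha', hl'⟩⟩
    refine ⟨_, .conj h ha ha', ?_⟩
    rintro l (h | h)
    exacts [hl l h, hl' l h]

theorem wellFounded_child (B : AndFBDD W) :
    WellFounded fun v u : B.Node => DiagramEdge B.label u v := by
  let _ := B.fintypeNode
  let r : B.Node → B.Node → Prop := fun v u => Relation.TransGen (DiagramEdge B.label) u v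
  have : IsTrans B.Node r := ⟨fun _ _ _ h₁ h₂ => h₂.trans h₁⟩
  have : Std.Irrefl r := ⟨B.acyclic⟩
  exact Subrelation.wf (r := r) (fun h => .single h) (Finite.wellFounded_of_trans_of_irrefl r)

theorem two_le_size (B : AndFBDD W) : 2 ≤ B.size := by
  let _ := B.fintypeNode
  obtain ⟨u, hu, -⟩ := B.two_sinks false
  obtain ⟨v, hv, -⟩ := B.two_sinks true
  have : u ≠ v := by
    rintro rfl
    simp_all
  exact Fintype.one_lt_card_iff.2 ⟨u, v, this⟩

/-! ### Pivots and the fooling set bound -/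

variable [DecidableEq W]

/-- The node `u` distinguishes `β` from each of the satisfying assignments obtained from `β` by
setting a variable of `I` to `0`, and decides satisfaction of the assignments that differ from `β`
only below `u`. -/
structure Pivot (B : AndFBDD W) (β : W → Bool) (I : Set W) (u : B.Node) : Prop where
  flip : ∀ q ∈ I, B.SatAt u (Function.update β q false)
  base : ¬ B.SatAt u β
  lift : ∀ v : W → Bool, (∀ x ∉ varsBelow B.label u, v x = β x) → B.SatAt u v → B.Sat v

theorem Pivot.mem_varsBelow {β : W → Bool} {I : Set W} {u : B.Node} (h : B.Pivot β I u)
    {q : W} (hq : q ∈ I) : q ∈ varsBelow B.label u := by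
  by_contra hn
  refine h.base ((h.flip q hq).congr fun x hx => ?_)
  exact Function.update_of_ne (by rintro rfl; exact hn hx) _ _

/-- Changing a single `q ∈ I` makes `l` accept, so `q` lies below `l` and, by decomposability, not
below `r`. Hence `r` accepts whatever agrees with `β` off `l`, and `l` alone decides. -/
theorem Pivot.descend_conj {β : W → Bool} {I : Set W} (hI : I.Nonempty) {u l r : B.Node}
    (h : B.Pivot β I u) (hl : DiagramEdge B.label u l)
    (hd : Disjoint (varsBelow B.label l) (varsBelow B.label r))
    (hs : ∀ b, B.SatAt u b ↔ B.SatAt l b ∧ B.SatAt r b) (hβ : ¬ B.SatAt l β) :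
    B.Pivot β I l := by
  have hp : ∀ q ∈ I, B.SatAt l (Function.update β q false) :=
    fun q hq => ((hs _).1 (h.flip q hq)).1
  refine ⟨hp, hβ, fun v hv hlv => ?_⟩
  refine h.lift v (fun x hx => hv x fun hx' => hx (varsBelow_mono hl hx')) ((hs v).2 ⟨hlv, ?_⟩)
  obtain ⟨q, hq⟩ := hI
  have hql : q ∈ varsBelow B.label l := by
    by_contra hn
    refine hβ ((hp q hq).congr fun x hx => ?_)
    exact Function.update_of_ne (by rintro rfl; exact hn hx) _ _
  refine ((hs _).1 (h.flip q hq)).2.congr fun x hx => ?_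
  have hxl : x ∉ varsBelow B.label l := fun hx' => Set.disjoint_left.1 hd hx' hx
  rw [hv x hxl, Function.update_of_ne]
  rintro rfl
  exact hxl hql

/-- Decisions on `P` are followed along `β`, which the flips respect because `I` avoids `P`. A sink
is impossible: it cannot distinguish `β` from a flip. -/
theorem Pivot.exists_decision {β : W → Bool} {I P : Set W} (hI : I.Nonempty)
    (hIP : Disjoint I P) {u : B.Node} (h : B.Pivot β I u) :
    ∃ w x lo hi, B.label w = .decision x lo hi ∧ x ∉ P ∧ B.Pivot β I w := by
  induction u using B.wellFounded_child.induction with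
  | _ u ih =>
  cases hu : B.label u with
  | sink i =>
    obtain ⟨q, hq⟩ := hI
    have h₁ := h.flip q hq
    have h₂ := h.base
    rw [satAt_sink hu] at h₁ h₂
    exact absurd h₁ h₂
  | conj l r =>
    have hd := B.decomposable u l r hu
    have hb := h.base
    rw [satAt_conj hu, not_and_or] at hb
    rcases hb with hb | hb
    · exact ih l (diagramEdge_left hu)
        (h.descend_conj hI (diagramEdge_left hu) hd (satAt_conj hu) hb)
    · exact ih r (diagramEdge_right hu)
        (h.descend_conj hI (diagramEdge_right hu) hd.symm
          (fun b => (satAt_conj hu b).trans and_comm) hb)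
  | decision x lo hi =>
    by_cases hx : x ∈ P
    swap
    · exact ⟨u, x, lo, hi, hu, hx, h⟩
    set w := if β x then hi else lo with hw
    have he : DiagramEdge B.label u w := by
      rw [hw]
      split
      exacts [diagramEdge_hi hu, diagramEdge_lo hu]
    -- By read-once, an assignment that differs from `β` only below `w` still takes the edge to `w`.
    have hxw : x ∉ varsBelow B.label w := by
      rintro ⟨w', lo', hi', hr, hw'⟩
      exact B.read_once u w' x _ _ _ _ hu hw' (.head' he hr)
    have hs : ∀ b : W → Bool, b x = β x → (B.SatAt u b ↔ B.SatAt w b) := by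
      intro b hb
      rw [satAt_decision hu, hb]
    refine ih w he ⟨fun q hq => ?_, fun hb => h.base ((hs β rfl).2 hb), fun v hv hwv => ?_⟩
    · refine (hs _ ?_).1 (h.flip q hq)
      rw [Function.update_of_ne]
      rintro rfl
      exact Set.disjoint_left.1 hIP hq hx
    · exact h.lift v (fun y hy => hv y fun hy' => hy (varsBelow_mono he hy'))
        ((hs v (hv x hxw)).2 hwv)

/-- The fooling set bound for `∧_d`-OBDDs, at an initial segment `P` of the variable order. -/
theorem card_le_size_of_fooling {π : LinearOrder W} (hπ : B.Obeys π) {P : Set W}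
    (hP : ∀ x y, π.lt x y → y ∈ P → x ∈ P) {Z : Type*} [Fintype Z] (β : Z → W → Bool)
    (I : Z → Set W) (hinj : Function.Injective I) (hne : ∀ z, (I z).Nonempty)
    (hIP : ∀ z, Disjoint (I z) P) (hβ : ∀ z z', ∀ x ∉ P, β z x = β z' x)
    (hbase : ∀ z, ¬ B.Sat (β z))
    (hflip : ∀ z, ∀ q ∈ I z, B.Sat (Function.update (β z) q false))
    (hfool : ∀ z z', ∀ q ∈ I z', q ∉ I z → ¬ B.Sat (Function.update (β z) q false)) :
    Fintype.card Z ≤ B.size := by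
  let _ := B.fintypeNode
  have hroot : ∀ z, B.Pivot (β z) (I z) B.source := fun z =>
    ⟨fun q hq => hflip z q hq, hbase z, fun _ _ h => h⟩
  choose w x lo hi hw hx hpiv using fun z => (hroot z).exists_decision (hne z) (hIP z)
  -- The variable at `w z` is outside `P`, and those further down are larger in the order.
  have hbelow : ∀ z, ∀ y ∈ varsBelow B.label (w z), y ∉ P := by
    rintro z y ⟨w', lo', hi', hr, hw'⟩ hy
    rcases Relation.reflTransGen_iff_eq_or_transGen.1 hr with rfl | hr
    · rw [hw z] at hw'
      cases hw'
      exact hx z hy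
    · exact hx z (hP _ _ (hπ _ _ _ _ _ _ _ _ (hw z) hw' hr) hy)
  -- At a common node, the flips of `β z` and `β z'` at `q ∈ I z'` agree on all variables below, so
  -- the flip of `β z` is accepted too; then `hfool` forces `q ∈ I z`.
  have key : ∀ z z', w z = w z' → I z' ⊆ I z := by
    intro z z' hzz q hq
    by_contra hn
    refine hfool z z' q hq hn ((hpiv z).lift _ (fun y hy => ?_) ?_)
    · refine Function.update_of_ne ?_ _ _
      rintro rfl
      exact hy (hzz ▸ (hpiv z').mem_varsBelow hq)
    · rw [hzz]
      refine ((hpiv z').flip q hq).congr fun y hy => ?_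
      rcases eq_or_ne y q with rfl | hyq
      · simp
      · simpa [hyq] using hβ z' z y (hbelow z' y hy)
  exact Fintype.card_le_of_injective w fun z z' h =>
    hinj ((key z' z h.symm).antisymm (key z z' h))

end AndFBDD

/-! ### Induced matchings that cross a prefix -/

namespace CNF

/-- The copy `v[1]` (for `s = true`) or `v[2]` (for `s = false`) of the vertex `v`. -/
def copy {V : Type} (s : Bool) (v : V) : V ⊕ V := if s then .inl v else .inr v

theorem copy_inj {V : Type} {s t : Bool} {u v : V} : copy s u = copy t v ↔ s = t ∧ u = v := by
  cases s <;> cases t <;> simp [copy]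

theorem sat_phi {W : Type} [Fintype W] [DecidableEq W] (G : SimpleGraph W)
    [DecidableRel G.Adj] (b : W → Bool) :
    (phi G).Sat b ↔ ∀ u v, G.Adj u v → b u = true ∨ b v = true := by
  constructor
  · intro h u v huv
    simpa using h _ (Finset.mem_image_of_mem _ (Finset.mem_filter.2 ⟨Finset.mem_univ (u, v), huv⟩))
  · intro h C hC
    obtain ⟨⟨u, v⟩, hp, rfl⟩ := Finset.mem_image.1 hC
    simpa using h u v (Finset.mem_filter.1 hp).2

theorem sat_union {W : Type} [DecidableEq W] (φ₁ φ₂ : CNF W) (b : W → Bool) :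
    Sat (φ₁ ∪ φ₂) b ↔ φ₁.Sat b ∧ φ₂.Sat b := by
  simp [Sat, Finset.mem_union, or_imp, forall_and]

theorem sat_psi {V : Type} [Fintype V] [DecidableEq V] (G : SimpleGraph V)
    [DecidableRel G.Adj] (b : V ⊕ V → Bool) :
    (psi G).Sat b ↔
      (∀ s u v, G.Adj u v → b (copy s u) = true ∨ b (copy (!s) v) = true) ∧
        ∀ s, ∃ v, b (copy s v) = false := by
  rw [psi, sat_union, sat_phi]
  simp [Sat, copy]
  tauto

end CNF

open CNF

/-- The empty set offers no flip, and the full set would leave no `0` in copy `s`, violating its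
all-negative clause; both are discarded from the fooling set. -/
theorem card_nonempty_proper {K : Type*} [Fintype K] [DecidableEq K] :
    2 ^ Fintype.card K ≤
      Fintype.card (Finset.univ \ {∅, Finset.univ} : Finset (Finset K)) + 2 := by
  rw [Fintype.card_coe]
  have h := Finset.le_card_sdiff ({∅, Finset.univ} : Finset (Finset K)) Finset.univ
  rw [Finset.card_univ, Fintype.card_finset] at h
  have := Finset.card_le_two (a := (∅ : Finset K)) (b := Finset.univ)
  omega

/-- An induced matching of `G` that crosses an initial segment of the variable order, from one copy
of the vertices to the other, forces many nodes. -/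
theorem AndFBDD.two_pow_card_le_size_of_crossing {V : Type} [Fintype V] [DecidableEq V]
    {B : AndFBDD (Option (V ⊕ V))} {π : LinearOrder (Option (V ⊕ V))} (hπ : B.Obeys π)
    {P : Set (Option (V ⊕ V))} (hP : ∀ x y, π.lt x y → y ∈ P → x ∈ P)
    (G : SimpleGraph V) [DecidableRel G.Adj] (c : Bool)
    (hB : ∀ b, b none = c → (B.Sat b ↔ (psi G).Sat fun x => b (some x)))
    {K : Type*} [Fintype K] [DecidableEq K] (s : Bool) (u v : K → V)
    (hadj : ∀ i k, G.Adj (u i) (v k) ↔ i = k) (hu : ∀ i, some (copy s (u i)) ∈ P)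
    (hv : ∀ i, some (copy (!s) (v i)) ∉ P) : 2 ^ Fintype.card K ≤ B.size + 2 := by
  let β : Finset K → Option (V ⊕ V) → Bool := fun I x =>
    x.elim c fun x => decide (∀ i ∉ I, x ≠ copy s (u i))
  let q : K → Option (V ⊕ V) := fun i => some (copy (!s) (v i))
  have hvinj : Function.Injective v := fun i k h => by
    rw [← hadj, ← h, hadj]
  have huinj : Function.Injective u := fun i k h => by
    rw [← hadj, h, hadj]
  have hqinj : Function.Injective q := fun i k h => by
    simpa [q, copy_inj, hvinj.eq_iff] using h
  have hβ' : ∀ I w, β I (some (copy (!s) w)) = true := by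
    intro I w
    simp [β, copy_inj]
  have hβs : ∀ I w, β I (some (copy s w)) = false ↔ ∃ i ∉ I, w = u i := by
    intro I w
    simp [β, copy_inj]
  refine card_nonempty_proper.trans (Nat.add_le_add_right
    (card_le_size_of_fooling hπ hP (fun I => β I.1) (fun I => q '' I.1) ?_ ?_ ?_ ?_ ?_ ?_ ?_) 2)
  · intro I J h
    exact Subtype.ext (Finset.coe_injective (hqinj.image_injective h))
  · rintro ⟨I, hI⟩
    simp only [Finset.mem_sdiff, Finset.mem_insert, Finset.mem_singleton, not_or] at hI
    exact (Finset.coe_nonempty.2 (Finset.nonempty_iff_ne_empty.2 hI.2.1)).image _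
  · rintro ⟨I, hI⟩
    rw [Set.disjoint_left]
    rintro _ ⟨i, -, rfl⟩
    exact hv i
  · rintro ⟨I, hI⟩ ⟨J, hJ⟩ x hx
    rcases x with _ | x
    · rfl
    · have : ∀ i, x ≠ copy s (u i) := by
        rintro i rfl
        exact hx (hu i)
      simp [β, this]
  · rintro ⟨I, hI⟩ h
    rw [hB _ rfl, sat_psi] at h
    obtain ⟨w, hw⟩ := h.2 (!s)
    simp [hβ'] at hw
  · rintro ⟨I, hI⟩ _ ⟨k, hk, rfl⟩
    simp only [Finset.mem_sdiff, Finset.mem_insert, Finset.mem_singleton, not_or] at hI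
    rw [hB _ (by simp [q, β]), sat_psi]
    have hs : ∀ w, Function.update (β I) (q k) false (some (copy s w)) = false ↔
        ∃ i ∉ I, w = u i := by
      intro w
      rw [Function.update_of_ne (by simp [q, copy_inj]), hβs]
    have hs' : ∀ w, Function.update (β I) (q k) false (some (copy (!s) w)) = false ↔
        w = v k := by
      intro w
      by_cases hw : w = v k
      · simp [hw, q]
      · rw [Function.update_of_ne (by simp [q, copy_inj, hw]), hβ']
        simp [hw]
    -- After the flip the zeros are the `u i` with `i ∉ I` and `v k` with `k ∈ I`; since the
    -- matching is induced, no edge joins two of them.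
    have key : ∀ a b, G.Adj a b →
        ¬ (Function.update (β I) (q k) false (some (copy s a)) = false ∧
          Function.update (β I) (q k) false (some (copy (!s) b)) = false) := by
      intro a b hab
      rw [hs, hs']
      rintro ⟨⟨i, hi, rfl⟩, rfl⟩
      rw [hadj] at hab
      exact hi (hab ▸ hk)
    refine ⟨fun t a b hab => ?_, fun t => ?_⟩
    · rcases Bool.eq_or_eq_not t s with rfl | rfl
      · have := key a b hab
        simp only [← Bool.not_eq_true] at this
        tauto
      · have := key b a hab.symm
        simp only [← Bool.not_eq_true, Bool.not_not] at this ⊢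
        tauto
    · rcases Bool.eq_or_eq_not t s with rfl | rfl
      · obtain ⟨i, hi⟩ : ∃ i, i ∉ I := by
          by_contra! h
          exact hI.2.2 (Finset.eq_univ_iff_forall.2 h)
        exact ⟨u i, (hs _).2 ⟨i, hi, rfl⟩⟩
      · exact ⟨v k, (hs' _).2 rfl⟩
  · rintro ⟨I, hI⟩ ⟨J, hJ⟩ _ ⟨k, hk, rfl⟩ hn h
    rw [hqinj.mem_set_image] at hn
    rw [hB _ (by simp [q, β]), sat_psi] at h
    have := h.1 s (u k) (v k) ((hadj k k).2 rfl)
    rw [Function.update_of_ne (by simp [q, copy_inj])] at this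
    have hk' := (hβs I (u k)).2 ⟨k, hn, rfl⟩
    simp [q, hk'] at this

/-- If `G` splits into lines and `par` is a proper 2-colouring of `G`, then many lines whose
`par`-coloured copies are split by an initial segment of the variable order force many nodes. -/
theorem AndFBDD.exists_two_pow_le_size_of_lines {V L : Type} [Fintype V] [DecidableEq V]
    [DecidableEq L]
    {B : AndFBDD (Option (V ⊕ V))} {π : LinearOrder (Option (V ⊕ V))} (hπ : B.Obeys π)
    {P : Set (Option (V ⊕ V))} (hP : ∀ x y, π.lt x y → y ∈ P → x ∈ P)
    (G : SimpleGraph V) [DecidableRel G.Adj] (c : Bool)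
    (hB : ∀ b, b none = c → (B.Sat b ↔ (psi G).Sat fun x => b (some x)))
    (line : V → L) (par : V → Bool) (hline : ∀ a b, G.Adj a b → line a = line b)
    (hpar : ∀ a b, G.Adj a b → par b = !par a) (M : Finset L)
    (hM : ∀ i ∈ M, ∃ u v, G.Adj u v ∧ line u = i ∧ some (copy (par u) u) ∈ P ∧
      some (copy (par v) v) ∉ P) :
    ∃ k, M.card ≤ 2 * k ∧ 2 ^ k ≤ B.size + 2 := by
  choose u v hadj hlu hu hv using fun i : M => hM i.1 i.2
  -- Fixing the parity of `u i` puts all these vertices into one copy; edges chosen from different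
  -- lines form an induced matching, as no edge joins two lines.
  have key : ∀ s, 2 ^ (Finset.univ.filter fun i => par (u i) = s).card ≤ B.size + 2 := by
    intro s
    rw [← Fintype.card_coe]
    have hs : ∀ i : {i // i ∈ Finset.univ.filter fun i => par (u i) = s}, par (u i.1) = s :=
      fun i => by simpa using i.2
    refine two_pow_card_le_size_of_crossing hπ hP G c hB s (fun i => u i.1) (fun i => v i.1)
      (fun i k => ⟨fun h => ?_, ?_⟩) (fun i => ?_) fun i => ?_
    · have h₁ := hline _ _ h
      rw [← hline _ _ (hadj k.1), hlu, hlu] at h₁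
      exact Subtype.ext (Subtype.ext h₁)
    · rintro rfl
      exact hadj _
    · simpa only [hs i] using hu i.1
    · simpa only [hpar _ _ (hadj i.1), hs i] using hv i.1
  have hcard : M.card = (Finset.univ.filter fun i => par (u i) = true).card +
      (Finset.univ.filter fun i => par (u i) = false).card := by
    rw [← Fintype.card_coe, ← Finset.card_univ,
      ← Finset.card_filter_add_card_filter_not fun i => par (u i) = true]
    simp
  rcases le_total (Finset.univ.filter fun i => par (u i) = true).card
    (Finset.univ.filter fun i => par (u i) = false).card with h | h
  · exact ⟨_, by omega, key false⟩
  · exact ⟨_, by omega, key true⟩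

/-! ### Balanced 2-colourings of the grid -/

/-- Pull the order back along `a`, list `V` increasingly, and take the down-closure of the first `k`
values. -/
theorem exists_lowerSet_card {W V : Type*} [π : LinearOrder W] [Fintype V] (a : V → W)
    (ha : Function.Injective a) (k : ℕ) :
    ∃ P : Set W, (∀ x y, x < y → y ∈ P → x ∈ P) ∧
      ∃ e : Fin (Fintype.card V) ≃ V, ∀ i, a (e i) ∈ P ↔ i.val < k := by
  let _ : LinearOrder V := LinearOrder.lift' a ha
  have hle : ∀ v w : V, v ≤ w ↔ a v ≤ a w := fun _ _ => Iff.rfl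
  let e := monoEquivOfFin V rfl
  refine ⟨{x | ∃ i : Fin (Fintype.card V), i.val < k ∧ x ≤ a (e i)}, ?_, e.toEquiv, fun i => ?_⟩
  · rintro x y hxy ⟨i, hi, hy⟩
    exact ⟨i, hi, hxy.le.trans hy⟩
  · constructor
    · rintro ⟨j, hj, hij⟩
      have : i ≤ j := e.le_iff_le.1 ((hle _ _).2 hij)
      exact lt_of_le_of_lt this hj
    · exact fun h => ⟨i, h, le_rfl⟩

/-- Every constant column meets the row `i₀`, hence has colour `s` and uses up `n` of the at most
`(n ^ 2 + 1) / 2` cells of that colour. -/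
theorem card_const_columns {n : ℕ} (c : Fin n → Fin n → Bool) {s : Bool}
    (hc : 2 * (Finset.univ.filter fun p : Fin n × Fin n => c p.1 p.2 = s).card ≤ n ^ 2 + 1)
    {i₀ : Fin n} (hi₀ : ∀ j, c i₀ j = s) :
    n ≤ 2 * (Finset.univ.filter fun j => ¬ ∀ i i', c i j = c i' j).card + 1 := by
  have hsum := Finset.card_filter_add_card_filter_not (s := (Finset.univ : Finset (Fin n)))
    fun j => ∀ i i', c i j = c i' j
  rw [Finset.card_univ, Fintype.card_fin] at hsum
  set m := (Finset.univ.filter fun j => ¬ ∀ i i', c i j = c i' j).card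
  set k := (Finset.univ.filter fun j => ∀ i i', c i j = c i' j).card with hk
  have hle : n * k ≤ (Finset.univ.filter fun p : Fin n × Fin n => c p.1 p.2 = s).card := by
    have hprod := Finset.card_product (Finset.univ : Finset (Fin n))
      (Finset.univ.filter fun j => ∀ i i', c i j = c i' j)
    rw [Finset.card_univ, Fintype.card_fin] at hprod
    rw [hk, ← hprod]
    refine Finset.card_le_card fun p hp => ?_
    simp only [Finset.mem_product, Finset.mem_filter, Finset.mem_univ, true_and] at hp ⊢
    rw [hp p.1 i₀, hi₀]
  have hn : 0 < n := i₀.pos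
  by_contra! h
  nlinarith

/-- Either some row is constant, which limits the constant columns, or every row is mixed. -/
theorem card_mixed_lines {n : ℕ} (c : Fin n → Fin n → Bool)
    (hc : ∀ s, 2 * (Finset.univ.filter fun p : Fin n × Fin n => c p.1 p.2 = s).card ≤ n ^ 2 + 1) :
    n ≤ 2 * (Finset.univ.filter fun i => ¬ ∀ j j', c i j = c i j').card + 1 ∨
      n ≤ 2 * (Finset.univ.filter fun j => ¬ ∀ i i', c i j = c i' j).card + 1 := by
  by_cases h : ∃ i, ∀ j j', c i j = c i j'
  · obtain ⟨i, hi⟩ := h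
    exact Or.inr (card_const_columns c (hc (c i i)) fun j => hi j i)
  · left
    push Not at h
    rw [Finset.filter_true_of_mem fun i _ => by
      obtain ⟨j, j', hj⟩ := h i
      exact fun h => hj (h j j')]
    simp
    omega

theorem exists_adjacent_ne {n : ℕ} (f : Fin n → Bool) (hf : ¬ ∀ j j', f j = f j') :
    ∃ j j' : Fin n, (j.val + 1 = j'.val ∨ j'.val + 1 = j.val) ∧ f j = true ∧ f j' = false := by
  by_contra! h
  have hstep : ∀ j j' : Fin n, j.val + 1 = j'.val → f j' = f j := by
    intro j j' hj
    have h₁ := h j j' (Or.inl hj)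
    have h₂ := h j' j (Or.inr hj)
    revert h₁ h₂
    cases f j <;> cases f j' <;> simp
  have h0 : ∀ k (hk : k < n), f ⟨k, hk⟩ = f ⟨0, by omega⟩ := by
    intro k
    induction k with
    | zero => exact fun _ => rfl
    | succ k ih => exact fun hk => (hstep ⟨k, by omega⟩ ⟨k + 1, hk⟩ rfl).trans (ih _)
  exact hf fun j j' => (h0 _ j.2).trans (h0 _ j'.2).symm

/-! ### The exponential lower bound -/

/-- The parity of a grid vertex. -/
def gridParity {n : ℕ} (p : Fin n × Fin n) : Bool := (p.1.val + p.2.val) % 2 == 0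

theorem gridParity_eq_not {n : ℕ} {p q : Fin n × Fin n}
    (h : p.1.val + p.2.val + 1 = q.1.val + q.2.val ∨ q.1.val + q.2.val + 1 = p.1.val + p.2.val) :
    gridParity q = !gridParity p := by
  have : (q.1.val + q.2.val) % 2 = 0 ↔ ¬ (p.1.val + p.2.val) % 2 = 0 := by omega
  rw [Bool.eq_iff_iff]
  simp [gridParity, this]

theorem AndFBDD.exists_two_pow_le_size {n : ℕ} {B : AndFBDD (GridVar n)} (hB : B.IsAndOBDD)
    (hr : B.Represents (psiGrid n)) : ∃ k, n ≤ 4 * k + 1 ∧ 2 ^ k ≤ B.size + 2 := by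
  classical
  obtain ⟨π, hπ⟩ := hB
  -- Neighbours have opposite parity, so the chosen copies of two neighbours are adjacent in the
  -- double cover.
  let a : Fin n × Fin n → GridVar n := fun p => some (copy (gridParity p) p)
  have ha : Function.Injective a := fun p q h => by
    simp only [a, Option.some.injEq, copy_inj] at h
    exact h.2
  obtain ⟨P, hP, e, he⟩ := @exists_lowerSet_card _ _ π _ a ha (n ^ 2 / 2)
  let c : Fin n → Fin n → Bool := fun i j => decide (a (i, j) ∈ P)
  have hV : Fintype.card (Fin n × Fin n) = n ^ 2 := by simp [sq]
  have hcard : ∀ s, (Finset.univ.filter fun p : Fin n × Fin n => c p.1 p.2 = s).card =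
      (Finset.univ.filter fun i : Fin (Fintype.card (Fin n × Fin n)) =>
        decide (i.val < n ^ 2 / 2) = s).card := by
    intro s
    refine (Finset.card_equiv e fun i => ?_).symm
    simp [c, he]
  have htrue : (Finset.univ.filter fun i : Fin (Fintype.card (Fin n × Fin n)) =>
      decide (i.val < n ^ 2 / 2) = true).card = n ^ 2 / 2 := by
    simp only [decide_eq_true_eq]
    rw [Fin.card_filter_val_lt]
    omega
  have hsum := Finset.card_filter_add_card_filter_not
    (s := (Finset.univ : Finset (Fin (Fintype.card (Fin n × Fin n)))))
    fun i => decide (i.val < n ^ 2 / 2) = true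
  rw [htrue, Finset.card_univ, Fintype.card_fin] at hsum
  replace hsum := hsum.trans hV
  have hfalse : (Finset.univ.filter fun i : Fin (Fintype.card (Fin n × Fin n)) =>
      decide (i.val < n ^ 2 / 2) = false).card = n ^ 2 - n ^ 2 / 2 := by
    rw [← Nat.eq_sub_of_add_eq' hsum]
    exact congrArg Finset.card (Finset.ext fun i => by simp)
  have hhalf : ∀ s,
      2 * (Finset.univ.filter fun p : Fin n × Fin n => c p.1 p.2 = s).card ≤ n ^ 2 + 1 := by
    rintro (_ | _)
    · rw [hcard, hfalse]
      omega
    · rw [hcard, htrue]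
      omega
  rcases card_mixed_lines c hhalf with h | h
  · obtain ⟨k, hk, hk'⟩ := exists_two_pow_le_size_of_lines hπ hP (horGrid n) true
      (fun b hb => by rw [hr.2, psiGrid, sat_junction]; simp [hb]) Prod.fst gridParity
      (fun p q h => h.1) (fun p q h => gridParity_eq_not (by
        have h₁ := congrArg Fin.val h.1
        have h₂ := h.2
        omega))
      (Finset.univ.filter fun i => ¬ ∀ j j', c i j = c i j') (fun i hi => by
        obtain ⟨j, j', hj, h₁, h₂⟩ := exists_adjacent_ne (c i) (Finset.mem_filter.1 hi).2
        exact ⟨(i, j), (i, j'), ⟨rfl, hj⟩, rfl, of_decide_eq_true h₁, of_decide_eq_false h₂⟩)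
    exact ⟨k, by omega, hk'⟩
  · obtain ⟨k, hk, hk'⟩ := exists_two_pow_le_size_of_lines hπ hP (vertGrid n) false
      (fun b hb => by rw [hr.2, psiGrid, sat_junction]; simp [hb]) Prod.snd gridParity
      (fun p q h => h.1) (fun p q h => gridParity_eq_not (by
        have h₁ := congrArg Fin.val h.1
        have h₂ := h.2
        omega))
      (Finset.univ.filter fun j => ¬ ∀ i i', c i j = c i' j) (fun j hj => by
        obtain ⟨i, i', hi, h₁, h₂⟩ :=
          exists_adjacent_ne (fun i => c i j) (Finset.mem_filter.1 hj).2
        exact ⟨(i, j), (i', j), ⟨rfl, hi⟩, rfl, of_decide_eq_true h₁, of_decide_eq_false h₂⟩)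
    exact ⟨k, by omega, hk'⟩

theorem AndFBDD.two_rpow_le_size {n : ℕ} {B : AndFBDD (GridVar n)} (hB : B.IsAndOBDD)
    (hr : B.Represents (psiGrid n)) : (2 : ℝ) ^ ((1 / 9 : ℝ) * (n : ℝ)) ≤ (B.size : ℝ) := by
  obtain ⟨k, hk, hs⟩ := exists_two_pow_le_size hB hr
  have h2 := B.two_le_size
  have hsq : 2 ^ k ≤ B.size ^ 2 := by nlinarith
  -- The fourth power of `size ^ 2` and one factor for the remaining `2 ≤ size` give the exponent
  -- `9`, hence the constant `1 / 9`.
  have hpow : 2 ^ n ≤ B.size ^ 9 := calc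
    2 ^ n ≤ 2 ^ (4 * k + 1) := Nat.pow_le_pow_right (by norm_num) hk
    _ = (2 ^ k) ^ 4 * 2 := by ring
    _ ≤ (B.size ^ 2) ^ 4 * B.size := by gcongr
    _ = B.size ^ 9 := by ring
  have hpow' : (2 : ℝ) ^ n ≤ (B.size : ℝ) ^ 9 := by exact_mod_cast hpow
  refine le_of_pow_le_pow_left₀ (n := 9) (by norm_num) (by positivity) ?_
  rw [← Real.rpow_mul_natCast (by norm_num)]
  have hexp : (1 / 9 : ℝ) * n * (9 : ℕ) = n := by
    push_cast
    ring
  rwa [hexp, Real.rpow_natCast]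

/-! ### FBDDs from read-once automata -/

/-- A branching program given by a finite automaton that chooses which variable to read next. -/
structure BranchingAutomaton (W S : Type) where
  /-- The initial state. -/
  start : S
  /-- The variable read at a time in a state. -/
  var : ℕ → S → W
  /-- The transition function. -/
  step : ℕ → S → Bool → S
  /-- The output. -/
  acc : S → Bool

namespace BranchingAutomaton

variable {W S : Type} (A : BranchingAutomaton W S)

/-- The state at time `t` on the assignment `b`. -/
def run (b : W → Bool) : ℕ → S
  | 0 => A.start
  | t + 1 => A.step t (run b t) (b (A.var t (run b t)))

/-- No variable is read twice before time `m`. -/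
def ReadOnce (m : ℕ) : Prop :=
  ∀ b t t', t < t' → t' < m → A.var t (A.run b t) ≠ A.var t' (A.run b t')

variable {A} {m : ℕ}

theorem ReadOnce.run_update [DecidableEq W] (h : A.ReadOnce m) {t : ℕ} (ht : t < m) (b : W → Bool) (i : Bool)
    {r : ℕ} (hr : r ≤ t) :
    A.run (Function.update b (A.var t (A.run b t)) i) r = A.run b r := by
  induction r with
  | zero => rfl
  | succ r ih =>
    rw [run, run, ih (by omega), Function.update_of_ne (h b r t (by omega) ht)]

theorem ReadOnce.run_update_succ [DecidableEq W] (h : A.ReadOnce m) {t : ℕ} (ht : t < m) (b : W → Bool)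
    (i : Bool) :
    A.run (Function.update b (A.var t (A.run b t)) i) (t + 1) = A.step t (A.run b t) i := by
  rw [run, h.run_update ht b i le_rfl, Function.update_self]

variable (A m) in
/-- The nodes: the reachable states at the times before `m`, and the sinks. -/
abbrev Node : Type := (Σ t : Fin m, Set.range fun b => A.run b t) ⊕ Bool

/-- The node for a reachable state. -/
def node (m t : ℕ) (s : S) (h : ∃ b, A.run b t = s) : A.Node m :=
  if ht : t < m then .inl ⟨⟨t, ht⟩, s, h⟩ else .inr (A.acc s)

variable (A m) in
/-- The node that is reached at time `t` on the assignment `b`. -/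
def nodeAt (b : W → Bool) (t : ℕ) : A.Node m := node m t (A.run b t) ⟨b, rfl⟩

theorem node_eq_nodeAt {t : ℕ} {s : S} {h : ∃ b, A.run b t = s} {b : W → Bool}
    (hb : A.run b t = s) : node m t s h = A.nodeAt m b t := by
  subst hb
  rfl

theorem nodeAt_of_le (b : W → Bool) {t : ℕ} (ht : m ≤ t) :
    A.nodeAt m b t = .inr (A.acc (A.run b t)) := by
  simp [nodeAt, node, ht.not_gt]

theorem nodeAt_of_lt (b : W → Bool) {t : ℕ} (ht : t < m) :
    A.nodeAt m b t = .inl ⟨⟨t, ht⟩, A.run b t, b, rfl⟩ := by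
  simp [nodeAt, node, ht]

theorem nodeAt_congr {b b' : W → Bool} {t : ℕ} (h : A.run b t = A.run b' t) :
    A.nodeAt m b t = A.nodeAt m b' t :=
  node_eq_nodeAt h.symm

theorem nodeAt_inj {b b' : W → Bool} {t t' : ℕ} (ht : t < m)
    (h : A.nodeAt m b t = A.nodeAt m b' t') : t' = t ∧ A.run b' t = A.run b t := by
  by_cases ht' : t' < m
  · rw [nodeAt_of_lt b ht, nodeAt_of_lt b' ht', Sum.inl.injEq] at h
    have h₁ : t = t' := congrArg (fun p => p.1.val) h
    subst h₁
    exact ⟨rfl, congrArg (fun p => p.2.1) h.symm⟩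
  · rw [nodeAt_of_lt b ht, nodeAt_of_le b' (not_lt.1 ht')] at h
    cases h

/-- `hacc` is what makes both sinks reachable; otherwise an unused sink would be a second source. -/
theorem exists_nodeAt_eq (hacc : ∀ i, ∃ b, A.acc (A.run b m) = i) (u : A.Node m) :
    ∃ b t, t ≤ m ∧ u = A.nodeAt m b t := by
  rcases u with ⟨t, _, b, rfl⟩ | i
  · exact ⟨b, t, t.2.le, (nodeAt_of_lt b t.2).symm⟩
  · obtain ⟨b, rfl⟩ := hacc i
    exact ⟨b, m, le_rfl, (nodeAt_of_le b le_rfl).symm⟩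

variable [DecidableEq W]

/-- The variable about to be read has not been read before, so its value can be reset without
changing the run so far. -/
theorem ReadOnce.exists_run_succ (h : A.ReadOnce m) (t : Fin m)
    (s : Set.range fun b => A.run b t) (i : Bool) :
    ∃ b, A.run b (t.val + 1) = A.step t s.1 i := by
  obtain ⟨_, b, rfl⟩ := s
  exact ⟨_, h.run_update_succ t.2 b i⟩

/-- The labels of the nodes. -/
def label (h : A.ReadOnce m) : A.Node m → NodeLabel W (A.Node m)
  | .inl ⟨t, s⟩ => .decision (A.var t s.1)
      (node m (t.val + 1) (A.step t s.1 false) (h.exists_run_succ t s false))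
      (node m (t.val + 1) (A.step t s.1 true) (h.exists_run_succ t s true))
  | .inr i => .sink i

theorem label_nodeAt (h : A.ReadOnce m) (b : W → Bool) {t : ℕ} (ht : t < m) :
    label h (A.nodeAt m b t) = .decision (A.var t (A.run b t))
      (A.nodeAt m (Function.update b (A.var t (A.run b t)) false) (t + 1))
      (A.nodeAt m (Function.update b (A.var t (A.run b t)) true) (t + 1)) := by
  rw [← node_eq_nodeAt (h := ⟨_, h.run_update_succ ht b false⟩) (h.run_update_succ ht b false),
    ← node_eq_nodeAt (h := ⟨_, h.run_update_succ ht b true⟩) (h.run_update_succ ht b true)]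
  simp only [nodeAt, node, ht, dite_true, label]

theorem edge_nodeAt (h : A.ReadOnce m) (b : W → Bool) {t : ℕ} (ht : t < m) :
    DiagramEdge (label h) (A.nodeAt m b t) (A.nodeAt m b (t + 1)) := by
  rw [DiagramEdge, label_nodeAt h b ht, NodeLabel.children]
  cases hb : b (A.var t (A.run b t))
  · left
    rw [← hb, Function.update_eq_self]
  · right
    rw [← hb, Function.update_eq_self]
    rfl

theorem exists_of_edge (h : A.ReadOnce m) {u v : A.Node m} (he : DiagramEdge (label h) u v) :
    ∃ b t, t < m ∧ u = A.nodeAt m b t ∧ v = A.nodeAt m b (t + 1) := by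
  rcases u with ⟨t, _, b, rfl⟩ | i
  · have hu := nodeAt_of_lt (A := A) b t.2
    have hr : ∀ i, A.nodeAt m b t =
        A.nodeAt m (Function.update b (A.var t (A.run b t)) i) t := fun i =>
      nodeAt_congr (h.run_update t.2 b i le_rfl).symm
    have he' : DiagramEdge (label h) (A.nodeAt m b t) v := hu ▸ he
    rw [DiagramEdge, label_nodeAt h b t.2] at he'
    rcases he' with rfl | rfl
    · exact ⟨_, t, t.2, hu.symm.trans (hr false), rfl⟩
    · exact ⟨_, t, t.2, hu.symm.trans (hr true), rfl⟩
  · simp [DiagramEdge, label, NodeLabel.children] at he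

/-- A whole directed path is traced by the run of one assignment, since each new answer can be
imposed without disturbing the past. Acyclicity and read-once of the diagram reduce to statements
about runs. -/
theorem exists_of_transGen (h : A.ReadOnce m) {u v : A.Node m}
    (he : Relation.TransGen (DiagramEdge (label h)) u v) :
    ∃ b t t', t < t' ∧ t' ≤ m ∧ u = A.nodeAt m b t ∧ v = A.nodeAt m b t' := by
  induction he with
  | single he =>
    obtain ⟨b, t, ht, hu, hv⟩ := exists_of_edge h he
    exact ⟨b, t, t + 1, by omega, ht, hu, hv⟩
  | tail _ he ih =>
    obtain ⟨b, t, t', htt, ht', hu, hv⟩ := ih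
    obtain ⟨b', t₁, ht₁, hv', hw⟩ := exists_of_edge h he
    obtain ⟨rfl, hrun⟩ := nodeAt_inj ht₁ (hv'.symm.trans hv)
    refine ⟨Function.update b (A.var t' (A.run b t')) (b' (A.var t' (A.run b t'))), t, t' + 1,
      by omega, ht₁, hu.trans (nodeAt_congr (h.run_update ht₁ b _ htt.le).symm),
      hw.trans (nodeAt_congr ?_)⟩
    rw [h.run_update_succ ht₁, run, hrun]

/-- The FBDD of a read-once branching automaton. -/
noncomputable def toFBDD (h : A.ReadOnce m) [Finite S] (hm : 0 < m)
    (hacc : ∀ i, ∃ b, A.acc (A.run b m) = i) : AndFBDD W where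
  Node := A.Node m
  fintypeNode := Fintype.ofFinite _
  label := label h
  source := A.nodeAt m (fun _ => false) 0
  acyclic u hu := by
    obtain ⟨b, t, t', htt, ht', hu, hu'⟩ := exists_of_transGen h hu
    have := (nodeAt_inj (by omega) (hu.symm.trans hu')).1
    omega
  single_source u := by
    constructor
    · intro hu
      obtain ⟨b, t, ht, rfl⟩ := exists_nodeAt_eq hacc u
      cases t with
      | zero => exact nodeAt_congr rfl
      | succ t => exact absurd (edge_nodeAt h b ht) (hu _)
    · rintro rfl w hw
      obtain ⟨b, t, ht, -, hw⟩ := exists_of_edge h hw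
      have := (nodeAt_inj hm hw).1
      omega
  two_sinks i := by
    refine ⟨.inr i, rfl, ?_⟩
    rintro (⟨t, s⟩ | j) hu
    · simp [label] at hu
    · simpa [label] using hu
  decomposable u l r hu := by
    rcases u with ⟨t, s⟩ | j <;> simp [label] at hu
  read_once u v x lo hi lo' hi' hu hv huv := by
    obtain ⟨b, t, t', htt, ht', rfl, rfl⟩ := exists_of_transGen h huv
    rcases ht'.lt_or_eq with ht' | rfl
    · rw [label_nodeAt h b (by omega)] at hu
      rw [label_nodeAt h b ht'] at hv
      injection hu with hu
      injection hv with hv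
      exact h b t t' htt ht' (hu.trans hv.symm)
    · rw [nodeAt_of_le b le_rfl] at hv
      simp [label] at hv

variable (h : A.ReadOnce m) [Finite S] (hm : 0 < m) (hacc : ∀ i, ∃ b, A.acc (A.run b m) = i)

theorem isFBDD_toFBDD : (toFBDD h hm hacc).IsFBDD := by
  rintro (⟨t, s⟩ | j) l r hu <;> simp [toFBDD, label] at hu

theorem size_toFBDD_le : (toFBDD h hm hacc).size ≤ m * Nat.card S + 2 := by
  have hsize : (toFBDD h hm hacc).size = Nat.card (A.Node m) :=
    @Fintype.card_eq_nat_card _ (toFBDD h hm hacc).fintypeNode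
  rw [hsize, Nat.card_sum]
  have h₁ : Nat.card (Σ t : Fin m, Set.range fun b => A.run b t) ≤ Nat.card (Fin m × S) := by
    refine Nat.card_le_card_of_injective (fun p => (p.1, p.2.1)) ?_
    rintro ⟨t, s⟩ ⟨t', s'⟩ hp
    simp only [Prod.mk.injEq] at hp
    obtain ⟨rfl, hp⟩ := hp
    rw [Subtype.ext hp]
  rw [Nat.card_prod] at h₁
  simpa using h₁

theorem mem_vars_toFBDD {b : W → Bool} {t : ℕ} (ht : t < m) :
    A.var t (A.run b t) ∈ (toFBDD h hm hacc).vars :=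
  ⟨A.nodeAt m b t, _, _, label_nodeAt h b ht⟩

theorem sat_toFBDD (b : W → Bool) : (toFBDD h hm hacc).Sat b ↔ A.acc (A.run b m) = true := by
  have key : ∀ d t, t + d = m →
      ((toFBDD h hm hacc).SatAt (A.nodeAt m b t) b ↔ A.acc (A.run b m) = true) := by
    intro d
    induction d with
    | zero =>
      rintro t rfl
      exact AndFBDD.satAt_sink (B := toFBDD h hm hacc)
        (congrArg (label h) (nodeAt_of_le b le_rfl)) b
    | succ d ih =>
      intro t ht
      rw [← ih (t + 1) (by omega), AndFBDD.satAt_decision (B := toFBDD h hm hacc)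
        (label_nodeAt h b (by omega))]
      cases hb : b (A.var t (A.run b t))
      · conv_lhs => rw [← hb, Function.update_eq_self]
        rw [hb]
        rfl
      · conv_lhs => rw [← hb, Function.update_eq_self]
        rw [hb]
        rfl
  have hs : (toFBDD h hm hacc).source = A.nodeAt m b 0 := nodeAt_congr rfl
  have := key m 0 (by omega)
  rw [← hs] at this
  exact this

end BranchingAutomaton

/-! ### The reading order -/

/-- The vertex at position `j` of the line `i`, lines being rows (`c = true`) or columns. -/
def gridPoint {n : ℕ} (c : Bool) (i j : Fin n) : Fin n × Fin n := if c then (i, j) else (j, i)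

theorem gridPoint_inj {n : ℕ} {c : Bool} {i j i' j' : Fin n} :
    gridPoint c i j = gridPoint c i' j' ↔ i = i' ∧ j = j' := by
  cases c <;> simp [gridPoint, and_comm]

theorem exists_gridPoint_eq {n : ℕ} (c : Bool) (v : Fin n × Fin n) :
    ∃ i j, v = gridPoint c i j := by
  cases c
  exacts [⟨v.2, v.1, rfl⟩, ⟨v.1, v.2, rfl⟩]

/-- The copy that is read at time `t`. -/
def gridSide (n t : ℕ) : Bool := (t / n + t % n) % 2 == 0

/-- The variable of `ψ` that is read at time `t`. Line by line, the two paths of the bipartite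
double cover of the line are read one after the other. -/
def gridVarAt (n : ℕ) [NeZero n] (c : Bool) (t : ℕ) : (Fin n × Fin n) ⊕ (Fin n × Fin n) :=
  copy (gridSide n t) (gridPoint c (Fin.ofNat n (t / n / 2)) (Fin.ofNat n (t % n)))

section

variable {n : ℕ}

theorem div_div_two_lt {t : ℕ} (ht : t < 2 * n ^ 2) : t / n / 2 < n := by
  have : t / n < 2 * n := Nat.div_lt_of_lt_mul (by nlinarith)
  omega

/-- The position gives `t % n`, the line gives `t / n / 2`, and the copy then gives the parity of `t
/ n`. -/
theorem gridVarAt_inj [NeZero n] {c : Bool} {t t' : ℕ} (ht : t < 2 * n ^ 2) (ht' : t' < 2 * n ^ 2)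
    (h : gridVarAt n c t = gridVarAt n c t') : t = t' := by
  simp only [gridVarAt, copy_inj, gridPoint_inj, Fin.ext_iff, Fin.val_ofNat, Nat.mod_mod] at h
  obtain ⟨hs, hi, hj⟩ := h
  rw [Nat.mod_eq_of_lt (div_div_two_lt ht), Nat.mod_eq_of_lt (div_div_two_lt ht')] at hi
  have hs' : (t / n + t % n) % 2 = 0 ↔ (t' / n + t' % n) % 2 = 0 := by
    simpa only [gridSide, beq_iff_eq] using Bool.eq_iff_iff.1 hs
  have hr : t / n = t' / n := by omega
  rw [← Nat.div_add_mod t n, ← Nat.div_add_mod t' n, hr, hj]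

/-- Block `r` is one of the two paths over the line `r / 2`; exactly one of these passes through
copy `s` at position `j`. -/
theorem exists_block (s : Bool) (i j : Fin n) :
    ∃ r, r < 2 * n ∧ r / 2 = i.val ∧ ((r + j.val) % 2 == 0) = s := by
  have hi := i.2
  cases s
  · refine ⟨2 * i.val + (j.val + 1) % 2, by omega, by omega, ?_⟩
    simp
    omega
  · refine ⟨2 * i.val + j.val % 2, by omega, by omega, ?_⟩
    simp
    omega

theorem block_lt {r : ℕ} (hr : r < 2 * n) (j : Fin n) : n * r + j.val < 2 * n ^ 2 := by
  have hj := j.2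
  nlinarith

theorem gridSide_block (r : ℕ) (j : Fin n) :
    gridSide n (n * r + j.val) = ((r + j.val) % 2 == 0) := by
  rw [gridSide, Nat.mul_add_div j.pos, Nat.div_eq_of_lt j.2, Nat.mul_add_mod,
    Nat.mod_eq_of_lt j.2, Nat.add_zero]

theorem gridVarAt_block [NeZero n] (c : Bool) {r : ℕ} (i j : Fin n) (hi : r / 2 = i.val) :
    gridVarAt n c (n * r + j.val) = copy ((r + j.val) % 2 == 0) (gridPoint c i j) := by
  rw [gridVarAt, gridSide_block, Nat.mul_add_div j.pos, Nat.div_eq_of_lt j.2, Nat.mul_add_mod,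
    Nat.mod_eq_of_lt j.2, Nat.add_zero, hi]
  simp

theorem exists_gridVarAt_eq [NeZero n] (c : Bool) (s : Bool) (v : Fin n × Fin n) :
    ∃ t, t < 2 * n ^ 2 ∧ gridSide n t = s ∧ gridVarAt n c t = copy s v := by
  obtain ⟨i, j, rfl⟩ := exists_gridPoint_eq c v
  obtain ⟨r, hr, hi, hs⟩ := exists_block s i j
  exact ⟨n * r + j.val, block_lt hr j, (gridSide_block r j).trans hs,
    (gridVarAt_block c i j hi).trans (by rw [hs])⟩

/-- Edges of the double cover join exactly the variables read consecutively within a block of length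
`n`; `t % n ≠ 0` excludes the first vertex of a path. -/
theorem sat_psi_lines [NeZero n] (G : SimpleGraph (Fin n × Fin n)) [DecidableRel G.Adj] (c : Bool)
    (hG : ∀ i j i' j', G.Adj (gridPoint c i j) (gridPoint c i' j') ↔
      i = i' ∧ (j.val + 1 = j'.val ∨ j'.val + 1 = j.val))
    (b : (Fin n × Fin n) ⊕ (Fin n × Fin n) → Bool) :
    (psi G).Sat b ↔
      (∀ t < 2 * n ^ 2, t % n ≠ 0 →
        b (gridVarAt n c (t - 1)) = true ∨ b (gridVarAt n c t) = true) ∧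
      ∀ s, ∃ t < 2 * n ^ 2, gridSide n t = s ∧ b (gridVarAt n c t) = false := by
  rw [sat_psi]
  refine and_congr ⟨fun h t ht htn => ?_, fun h => ?_⟩ (forall_congr' fun s => ⟨?_, ?_⟩)
  · have hn := NeZero.pos n
    have hlt := Nat.mod_lt t hn
    let i : Fin n := ⟨t / n / 2, div_div_two_lt ht⟩
    let j : Fin n := ⟨t % n, hlt⟩
    let j₀ : Fin n := ⟨t % n - 1, by omega⟩
    have ht₁ : t = n * (t / n) + j.val := (Nat.div_add_mod t n).symm
    have ht₀ : t - 1 = n * (t / n) + j₀.val := by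
      have : j₀.val + 1 = j.val := by
        simp only [j₀, j]
        omega
      omega
    have hadj : G.Adj (gridPoint c i j₀) (gridPoint c i j) := by
      rw [hG]
      refine ⟨rfl, Or.inl ?_⟩
      simp only [j₀, j]
      omega
    have hside : ((t / n + j.val) % 2 == 0) = !((t / n + j₀.val) % 2 == 0) := by
      have : (t / n + j.val) % 2 = 0 ↔ ¬ (t / n + j₀.val) % 2 = 0 := by
        simp only [j₀, j]
        omega
      rw [Bool.eq_iff_iff]
      simp [this]
    have e₁ := gridVarAt_block c i j rfl
    have e₀ := gridVarAt_block c i j₀ rfl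
    simp only [i] at e₀ e₁
    rw [← ht₁, hside] at e₁
    rw [← ht₀] at e₀
    rw [e₀, e₁]
    exact h _ _ _ hadj
  · have key : ∀ s (i j j' : Fin n), j.val + 1 = j'.val →
        b (copy s (gridPoint c i j)) = true ∨ b (copy (!s) (gridPoint c i j')) = true := by
      intro s i j j' hj
      obtain ⟨r, hr, hi, hs⟩ := exists_block s i j
      have hs' : ((r + j'.val) % 2 == 0) = !s := by
        have : (r + j'.val) % 2 = 0 ↔ ¬ (r + j.val) % 2 = 0 := by omega
        rw [Bool.eq_iff_iff, ← hs]
        simp [this]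
      have := h (n * r + j'.val) (block_lt hr j') (by
        rw [Nat.mul_add_mod, Nat.mod_eq_of_lt j'.2]
        omega)
      have e : n * r + j'.val - 1 = n * r + j.val := by omega
      rwa [e, gridVarAt_block c i j hi, gridVarAt_block c i j' hi, hs, hs'] at this
    intro s u v huv
    obtain ⟨i, j, rfl⟩ := exists_gridPoint_eq c u
    obtain ⟨i', j', rfl⟩ := exists_gridPoint_eq c v
    obtain ⟨rfl, hj | hj⟩ := (hG _ _ _ _).1 huv
    · exact key s i j j' hj
    · simpa using (key (!s) i j' j hj).symm
  · rintro ⟨v, hv⟩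
    obtain ⟨t, ht, hts, htv⟩ := exists_gridVarAt_eq c s v
    exact ⟨t, ht, hts, by rw [htv, hv]⟩
  · rintro ⟨t, -, rfl, ht⟩
    exact ⟨_, ht⟩

end

/-! ### The automaton for the grid CNF -/

/-- A state consists of the value of the junction variable, the value read last, for either copy
whether no variable of it was `0`, and whether no edge was violated. -/
abbrev GridState : Type := Bool × Bool × Bool × Bool × Bool

/-- The transitions of `gridAutomaton`. -/
def gridStep (n : ℕ) : ℕ → GridState → Bool → GridState
  | 0, _, i => (i, true, true, true, true)
  | t + 1, (c, p, a₁, a₂, e), i =>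
    (c, i, a₁ && (!gridSide n t || i), a₂ && (gridSide n t || i), e && (t % n == 0 || (p || i)))

/-- The automaton that evaluates `ψ(G_n, E_hor, E_vert)`. -/
def gridAutomaton (n : ℕ) [NeZero n] : BranchingAutomaton (GridVar n) GridState where
  start := (true, true, true, true, true)
  var
    | 0, _ => none
    | t + 1, s => some (gridVarAt n s.1 t)
  step := gridStep n
  acc s := s.2.2.2.2 && (!s.2.2.1 && !s.2.2.2.1)

section

variable {n : ℕ} [NeZero n]

theorem run_fst (b : GridVar n → Bool) (t : ℕ) :
    ((gridAutomaton n).run b (t + 1)).1 = b none := by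
  induction t with
  | zero => rfl
  | succ t ih => exact ih

theorem run_var (b : GridVar n → Bool) (t : ℕ) :
    (gridAutomaton n).var (t + 1) ((gridAutomaton n).run b (t + 1)) =
      some (gridVarAt n (b none) t) := by
  rw [← run_fst b t]
  rfl

theorem run_eq (b : GridVar n → Bool) (t : ℕ) :
    (gridAutomaton n).run b (t + 2) = gridStep n (t + 1) ((gridAutomaton n).run b (t + 1))
      (b (some (gridVarAt n (b none) t))) := by
  rw [← run_var]
  rfl

theorem run_last (b : GridVar n → Bool) (t : ℕ) :
    ((gridAutomaton n).run b (t + 2)).2.1 = b (some (gridVarAt n (b none) t)) := by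
  rw [run_eq]
  rfl

theorem run_all_true (b : GridVar n → Bool) (t : ℕ) :
    ((gridAutomaton n).run b (t + 1)).2.2.1 = true ↔
      ∀ r < t, gridSide n r = true → b (some (gridVarAt n (b none) r)) = true := by
  induction t with
  | zero => simp [BranchingAutomaton.run, gridAutomaton, gridStep]
  | succ t ih =>
    rw [Nat.forall_lt_succ_right, ← ih, run_eq]
    simp only [gridStep, Bool.and_eq_true, Bool.or_eq_true, Bool.not_eq_true']
    cases gridSide n t <;> simp

theorem run_all_false (b : GridVar n → Bool) (t : ℕ) :
    ((gridAutomaton n).run b (t + 1)).2.2.2.1 = true ↔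
      ∀ r < t, gridSide n r = false → b (some (gridVarAt n (b none) r)) = true := by
  induction t with
  | zero => simp [BranchingAutomaton.run, gridAutomaton, gridStep]
  | succ t ih =>
    rw [Nat.forall_lt_succ_right, ← ih, run_eq]
    simp only [gridStep, Bool.and_eq_true, Bool.or_eq_true]
    cases gridSide n t <;> simp

theorem run_edges (b : GridVar n → Bool) (t : ℕ) :
    ((gridAutomaton n).run b (t + 1)).2.2.2.2 = true ↔
      ∀ r < t, r % n ≠ 0 → b (some (gridVarAt n (b none) (r - 1))) = true ∨
        b (some (gridVarAt n (b none) r)) = true := by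
  induction t with
  | zero => simp [BranchingAutomaton.run, gridAutomaton, gridStep]
  | succ t ih =>
    rw [Nat.forall_lt_succ_right, ← ih, run_eq]
    simp only [gridStep, Bool.and_eq_true, Bool.or_eq_true, beq_iff_eq]
    refine and_congr_right fun _ => ?_
    cases t with
    | zero => simp
    | succ t =>
      rw [run_last, Nat.add_sub_cancel]
      tauto

theorem acc_run_iff (b : GridVar n → Bool) :
    (gridAutomaton n).acc ((gridAutomaton n).run b (2 * n ^ 2 + 1)) = true ↔
      (psiGrid n).Sat b := by
  have h₁ := run_all_true b (2 * n ^ 2)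
  have h₂ := run_all_false b (2 * n ^ 2)
  have h₃ := run_edges b (2 * n ^ 2)
  have hacc : ∀ s : GridState, (gridAutomaton n).acc s = true ↔
      s.2.2.2.2 = true ∧ ¬ s.2.2.1 = true ∧ ¬ s.2.2.2.1 = true := by
    simp [gridAutomaton]
  rw [hacc, h₁, h₂, h₃, psiGrid, sat_junction]
  have hhor := sat_psi_lines (horGrid n) true (fun i j i' j' => Iff.rfl) fun x => b (some x)
  have hvert := sat_psi_lines (vertGrid n) false (fun i j i' j' => Iff.rfl) fun x => b (some x)
  push Not
  rw [hhor, hvert]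
  cases hb : b none <;> simp [and_comm]

theorem gridAutomaton_readOnce : (gridAutomaton n).ReadOnce (2 * n ^ 2 + 1) := by
  intro b t t' htt ht'
  obtain ⟨t', rfl⟩ : ∃ r, t' = r + 1 := ⟨t' - 1, by omega⟩
  rw [run_var]
  cases t with
  | zero => exact (Option.some_ne_none _).symm
  | succ t =>
    rw [run_var]
    intro h
    have := gridVarAt_inj (by omega) (by omega) (Option.some_injective _ h)
    omega

end

/-! ### Variables, size and conclusion -/

theorem CNF.mem_vars_guard {W : Type} [DecidableEq W] {i : Bool} {φ : CNF W}
    {C : Finset (Lit W)} (hC : C ∈ φ) {x : Option W}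
    (hx : x = none ∨ ∃ l ∈ C, some l.1 = x) : x ∈ (guard i φ).vars := by
  refine Finset.mem_biUnion.2 ⟨_, Finset.mem_image_of_mem _ hC, Finset.mem_image.2 ?_⟩
  rcases hx with rfl | ⟨l, hl, rfl⟩
  · exact ⟨_, Finset.mem_insert_self _ _, rfl⟩
  · exact ⟨_, Finset.mem_insert_of_mem (Finset.mem_image_of_mem _ hl), rfl⟩

/-- The two guarded all-negative clauses of the horizontal half already contain every variable. -/
theorem vars_psiGrid (n : ℕ) : (psiGrid n).vars = Finset.univ := by
  rw [Finset.eq_univ_iff_forall]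
  have hsub : (guard false (psi (horGrid n))).vars ⊆ (psiGrid n).vars :=
    Finset.biUnion_subset_biUnion_of_subset_left _ Finset.subset_union_left
  have hl : Finset.univ.image (fun v => (Sum.inl v, false)) ∈ psi (horGrid n) :=
    Finset.mem_union_right _ (Finset.mem_insert_self _ _)
  have hr : Finset.univ.image (fun v => (Sum.inr v, false)) ∈ psi (horGrid n) :=
    Finset.mem_union_right _ (Finset.mem_insert_of_mem (Finset.mem_singleton_self _))
  rintro (_ | v | v)
  · exact hsub (mem_vars_guard hl (Or.inl rfl))
  · exact hsub (mem_vars_guard hl (Or.inr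
      ⟨(Sum.inl v, false), Finset.mem_image_of_mem _ (Finset.mem_univ v), rfl⟩))
  · exact hsub (mem_vars_guard hr (Or.inr
      ⟨(Sum.inr v, false), Finset.mem_image_of_mem _ (Finset.mem_univ v), rfl⟩))

theorem card_vars_psiGrid (n : ℕ) : (psiGrid n).vars.card = 2 * n ^ 2 + 1 := by
  rw [vars_psiGrid, Finset.card_univ, Fintype.card_option, Fintype.card_sum, Fintype.card_prod,
    Fintype.card_fin]
  ring

/-- The assignment that falsifies one vertex in each copy satisfies the CNF, the assignment that
makes every vertex true does not. -/
theorem exists_acc_run_eq {n : ℕ} [NeZero n] (i : Bool) :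
    ∃ b, (gridAutomaton n).acc ((gridAutomaton n).run b (2 * n ^ 2 + 1)) = i := by
  cases i
  · refine ⟨fun _ => true, ?_⟩
    rw [← Bool.not_eq_true, acc_run_iff, psiGrid, sat_junction]
    intro h
    obtain ⟨v, hv⟩ := ((sat_psi _ _).1 (h.1 rfl)).2 true
    cases hv
  -- The two zeros are copies of the same vertex, which are not adjacent in the double cover because
  -- `G` has no loops.
  · refine ⟨fun x => x.elim true fun x => decide (x ≠ copy true 0 ∧ x ≠ copy false 0), ?_⟩
    rw [acc_run_iff, psiGrid, sat_junction]
    refine ⟨fun _ => (sat_psi _ _).2 ⟨?_, ?_⟩, by simp⟩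
    · intro s u v huv
      have hne := huv.ne
      by_contra h
      simp only [not_or, Bool.not_eq_true] at h
      cases s <;> simp [copy_inj] at h <;> exact hne (h.1.trans h.2.symm)
    · intro s
      exact ⟨0, by cases s <;> simp⟩

theorem exists_isFBDD_psiGrid {n : ℕ} (hn : 0 < n) : ∃ B : AndFBDD (GridVar n),
    B.IsFBDD ∧ B.Represents (psiGrid n) ∧ B.size ≤ 98 * n ^ 2 := by
  have : NeZero n := ⟨hn.ne'⟩
  let h := gridAutomaton_readOnce (n := n)
  have hm : 0 < 2 * n ^ 2 + 1 := Nat.succ_pos _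
  refine ⟨BranchingAutomaton.toFBDD h hm exists_acc_run_eq,
    BranchingAutomaton.isFBDD_toFBDD h hm _, ⟨?_, fun b => ?_⟩, ?_⟩
  · rw [vars_psiGrid, Finset.coe_univ, Set.eq_univ_iff_forall]
    have hvar : ∀ s v, (some (copy s v) : GridVar n) ∈
        (BranchingAutomaton.toFBDD h hm exists_acc_run_eq).vars := by
      intro s v
      obtain ⟨t, ht, -, htv⟩ := exists_gridVarAt_eq true s v
      have := BranchingAutomaton.mem_vars_toFBDD h hm exists_acc_run_eq (b := fun _ => true)
        (Nat.succ_lt_succ ht)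
      rwa [run_var, htv] at this
    rintro (_ | v | v)
    · exact BranchingAutomaton.mem_vars_toFBDD h hm exists_acc_run_eq (b := fun _ => true) hm
    · exact hvar true v
    · exact hvar false v
  · rw [BranchingAutomaton.sat_toFBDD, acc_run_iff]
  · have := BranchingAutomaton.size_toFBDD_le h hm exists_acc_run_eq
    have hS : Nat.card GridState = 32 := by simp [GridState]
    rw [hS] at this
    -- `32 * (2 * n ^ 2 + 1) + 2 = 64 * n ^ 2 + 34`, and `n ^ 2 ≥ 1`.
    nlinarith [Nat.pow_le_pow_left hn 2]

theorem theorem3p2 :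
    (∀ n : ℕ, 0 < n → (psiGrid n).vars.card = 2 * n ^ 2 + 1) ∧
    (∃ C k : ℕ, ∀ n : ℕ, 0 < n → ∃ B : AndFBDD (GridVar n),
      B.IsFBDD ∧ B.Represents (psiGrid n) ∧ B.size ≤ C * n ^ k) ∧
    (∃ c : ℝ, 0 < c ∧ ∀ n : ℕ, 0 < n → ∀ B : AndFBDD (GridVar n),
      B.IsAndOBDD → B.Represents (psiGrid n) → (2 : ℝ) ^ (c * (n : ℝ)) ≤ (B.size : ℝ)) :=
  ⟨fun n _ => card_vars_psiGrid n, ⟨98, 2, fun _ hn => exists_isFBDD_psiGrid hn⟩,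
    1 / 9, by norm_num, fun _ _ _ hB hr => AndFBDD.two_rpow_le_size hB hr⟩
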